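/- \textbf{Language.} Fix an infinite set $\mathbf V$ of variables, and sets $\mathbf N$ of names, $\mathbf I$ of agents and $\mathbf P$ of predicate symbols, each with a finite arity. Terms are $t ::= x \mid a$ ($x\in\mathbf V$, $a\in\mathbf N$). The formulas of $\mathbf{PALAS}$ are $$\varphi ::= t\approx t' \mid P\vec t \mid (\varphi\wedge\varphi)\mid \neg\varphi\mid \mathsf K_i\varphi\mid [x:=t]\varphi\mid [!\varphi]\varphi ,$$ with the usual abbreviations $\to,\leftrightarrow,\top$ and $\langle x:=t\rangle\varphi := \neg[x:=t]\neg\varphi$; $t\approx t'$ and $P\vec t$ are the atomic formulas. The operator $[x:=t]$ binds $x$ in its scope (not in $t$); $\varphi[y/x]$ is the result of replacing all free occurrences of $x$ in $\varphi$ by $y$, and it is admissible if all occurrences of $y$ so introduced are free. \textbf{Semantics.} A (constant-domain) Kripke model $\mathcal M=\langle W,D,R,\rho,\eta\rangle$ has a non-empty set $W$ of worlds, a non-empty domain $D$, an arbitrary relation $R_i\subseteq W\times W$ for each agent $i$, an $n$-ary relation $\rho(P,w)$ on $D$ for each $n$-ary $P$ and world $w$, and an element $\eta(a,w)\in D$ for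 each name $a$ and world $w$. For $\sigma:\mathbf V\to D$ let $\sigma_w(x)=\sigma(x)$ and $\sigma_w(a)=\eta(a,w)$. Truth at $\mathcal M,w,\sigma$ is defined by the usual clauses for $\approx$, $P$, $\wedge$, $\neg$, by $\mathcal M,w,\sigma\vDash\mathsf K_i\varphi$ iff $\mathcal M,v,\sigma\vDash\varphi$ for all $v$ with $wR_iv$; $\mathcal M,w,\sigma\vDash[x:=t]\varphi$ iff $\mathcal M,w,\sigma[x\mapsto\sigma_w(t)]\vDash\varphi$; and $\mathcal M,w,\sigma\vDash[!\psi]\varphi$ iff $\mathcal M,w,\sigma\vDash\psi$ implies $\mathcal M|^\sigma_\psi,w,\sigma\vDash\varphi$, where $\mathcal M|^\sigma_\psi$ is the restriction of $\mathcal M$ to the worlds $v$ with $\mathcal M,v,\sigma\vDash\psi$. A formula is valid ($\vDash\varphi$) if it is true at every $\mathcal M,w,\sigma$. \textbf{Proof system.} $\mathsf{SPALAS}$ has as axioms all $\mathbf{PALAS}$ instances of the following schemas. The schemas of $\mathsf{SBELAS}$: all instances of propositional tautologies; $\mathsf K_i(\varphi\to\psi)\to(\mathsf K_i\varphi\to\mathsf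 K_i\psi)$; $t\approx t$; $t\approx t'\leftrightarrow t'\approx t$; $t\approx t'\wedge t'\approx t''\to t\approx t''$; $t\approx t'\to([x:=t]\varphi\leftrightarrow[x:=t']\varphi)$; $\vec t\approx\vec t'\to(P\vec t\leftrightarrow P\vec t')$ (where $\vec t\approx\vec t'$ is the conjunction of the pointwise equalities); $x\approx y\to\mathsf K_i\,x\approx y$; $x\not\approx y\to\mathsf K_i\,x\not\approx y$; $[x:=t](\varphi\to\psi)\to([x:=t]\varphi\to[x:=t]\psi)$; $\langle x:=t\rangle\varphi\to[x:=t]\varphi$; $\langle x:=t\rangle\top$; $[x:=t]\,x\approx t$; $\varphi[y/x]\to[x:=y]\varphi$ if $\varphi[y/x]$ is admissible. The reduction axioms: \begin{itemize} \item $[!\psi]p\leftrightarrow(\psi\to p)$ for atomic $p$; \item $[!\psi]\neg\varphi\leftrightarrow(\psi\to\neg[!\psi]\varphi)$; \item $[!\psi](\varphi\wedge\chi)\leftrightarrow([!\psi]\varphi\wedge[!\psi]\chi)$; \item $[!\psi]\mathsf K_i\varphi\leftrightarrow(\psi\to\mathsf K_i[!\psi]\varphi)$; \item $[!\psi][!\chi]\varphi\leftrightarrow[!(\psi\wedge[!\psi]\chi)]\varphi$;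 \item (AASSI) $[!\psi][x:=t]\varphi\leftrightarrow[z:=x][x:=t][!\psi[z/x]]\varphi$, where $z$ does not occur in $[!\psi][x:=t]\varphi$. \end{itemize} The rules are: from $\varphi$ infer $\mathsf K_i\varphi$; from $\varphi$ and $\varphi\to\psi$ infer $\psi$; from $\varphi\to\psi$ infer $\varphi\to[x:=t]\psi$, provided $x$ is not free in $\varphi$. Write $\vdash_{\mathsf{SPALAS}}\varphi$ if $\varphi$ is derivable. \textbf{Theorem.} $\mathsf{SPALAS}$ is complete over arbitrary models: for every $\mathbf{PALAS}$ formula $\varphi$, if $\vDash\varphi$ then $\vdash_{\mathsf{SPALAS}}\varphi$. -/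

import Mathlib

universe u

namespace PALAS

/-- Terms: variables and names. -/
inductive Term (V N : Type u) : Type u
  | var : V → Term V N
  | name : N → Term V N

/-- Formulas of public announcement logic with assignments, over variables `V`, names `N`,
agents `I` and predicate symbols `P` with arities `ar`. -/
inductive Formula (V N I P : Type u) (ar : P → ℕ) : Type u
  /-- `t ≈ t'` -/
  | eq : Term V N → Term V N → Formula V N I P ar
  /-- `P t₁ … tₙ` -/
  | pred : (p : P) → (Fin (ar p) → Term V N) → Formula V N I P ar
  | and : Formula V N I P ar → Formula V N I P ar → Formula V N I P ar
  | neg : Formula V N I P ar → Formula V N I P ar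
  /-- `K_i φ` -/
  | know : I → Formula V N I P ar → Formula V N I P ar
  /-- `[x := t] φ` -/
  | assign : V → Term V N → Formula V N I P ar → Formula V N I P ar
  /-- `announce ψ φ` is `[!ψ] φ` -/
  | announce : Formula V N I P ar → Formula V N I P ar → Formula V N I P ar

/-- The set of variables of a term. -/
def Term.vars {V N : Type u} : Term V N → Set V
  | .var x => {x}
  | .name _ => ∅

/-- Replace the variable `x` by the variable `y` in a term. -/
def Term.subst {V N : Type u} [DecidableEq V] (y x : V) : Term V N → Term V N
  | .var v => if v = x then .var y else .var v
  | .name a => .name a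

namespace Formula

variable {V N I P : Type u} {ar : P → ℕ}

/-- Material implication. -/
def imp (φ ψ : Formula V N I P ar) : Formula V N I P ar := neg (and φ (neg ψ))

/-- Material equivalence. -/
def iff (φ ψ : Formula V N I P ar) : Formula V N I P ar := and (imp φ ψ) (imp ψ φ)

/-- `⊤`, a fixed propositional tautology. -/
noncomputable def top [Nonempty V] : Formula V N I P ar :=
  imp (eq (.var (Classical.arbitrary V)) (.var (Classical.arbitrary V)))
    (eq (.var (Classical.arbitrary V)) (.var (Classical.arbitrary V)))

/-- The conjunction of a list of formulas. -/
noncomputable def conj [Nonempty V] : List (Formula V N I P ar) → Formula V N I P ar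
  | [] => top
  | φ :: l => and φ (conj l)

/-- `⟨x := t⟩ φ`, the dual of `[x := t] φ`. -/
def dualAssign (x : V) (t : Term V N) (φ : Formula V N I P ar) : Formula V N I P ar :=
  neg (assign x t (neg φ))

/-- Atomic formulas: `t ≈ t'` and `P t₁ … tₙ`. -/
def IsAtomic : Formula V N I P ar → Prop
  | eq _ _ => True
  | pred _ _ => True
  | _ => False

/-- Free variables; `[x := t]` binds `x` in its scope, but not in `t`. -/
def freeVars : Formula V N I P ar → Set V
  | eq t t' => t.vars ∪ t'.vars
  | pred _ ts => ⋃ k, (ts k).vars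
  | and φ ψ => freeVars φ ∪ freeVars ψ
  | neg φ => freeVars φ
  | know _ φ => freeVars φ
  | assign x t φ => (freeVars φ \ {x}) ∪ t.vars
  | announce ψ φ => freeVars ψ ∪ freeVars φ

/-- All variables occurring in a formula, free or bound. -/
def vars : Formula V N I P ar → Set V
  | eq t t' => t.vars ∪ t'.vars
  | pred _ ts => ⋃ k, (ts k).vars
  | and φ ψ => vars φ ∪ vars ψ
  | neg φ => vars φ
  | know _ φ => vars φ
  | assign x t φ => {x} ∪ t.vars ∪ vars φ
  | announce ψ φ => vars ψ ∪ vars φ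

/-- `subst y x φ` is `φ[y/x]`: every free occurrence of `x` in `φ` is replaced by `y`. -/
def subst [DecidableEq V] (y x : V) : Formula V N I P ar → Formula V N I P ar
  | eq t t' => eq (t.subst y x) (t'.subst y x)
  | pred p ts => pred p (fun k => (ts k).subst y x)
  | and φ ψ => and (subst y x φ) (subst y x ψ)
  | neg φ => neg (subst y x φ)
  | know i φ => know i (subst y x φ)
  | assign v t φ => assign v (t.subst y x) (if v = x then φ else subst y x φ)
  | announce ψ φ => announce (subst y x ψ) (subst y x φ)

/-- `Admissible y x φ`: `φ[y/x]` is admissible, i.e. no `y` that replaces a free occurrence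
of `x` in `φ` gets bound. -/
def Admissible (y x : V) : Formula V N I P ar → Prop
  | eq _ _ => True
  | pred _ _ => True
  | and φ ψ => Admissible y x φ ∧ Admissible y x ψ
  | neg φ => Admissible y x φ
  | know _ φ => Admissible y x φ
  | assign v _ φ => v = x ∨ ((x ∈ freeVars φ → v ≠ y) ∧ Admissible y x φ)
  | announce ψ φ => Admissible y x ψ ∧ Admissible y x φ

/-- Instances of propositional tautologies: formulas true under every valuation that respects
`¬` and `∧` and treats all other formulas as propositional letters. -/
def IsTautology (φ : Formula V N I P ar) : Prop :=
  ∀ v : Formula V N I P ar → Prop,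
    (∀ χ, v (neg χ) ↔ ¬ v χ) → (∀ χ ξ, v (and χ ξ) ↔ v χ ∧ v ξ) → v φ

end Formula

/-- Constant-domain first-order Kripke models. -/
structure Model (N I P : Type u) (ar : P → ℕ) where
  /-- worlds -/
  W : Type u
  /-- objects -/
  D : Type u
  nonempty_W : Nonempty W
  nonempty_D : Nonempty D
  /-- accessibility relations -/
  R : I → W → W → Prop
  /-- interpretation of predicate symbols at each world -/
  ρ : (p : P) → W → (Fin (ar p) → D) → Prop
  /-- interpretation of names at each world -/
  η : N → W → D

/-- The submodel given by a nonempty set of worlds, represented as a predicate. -/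
abbrev Model.restrict {N I P : Type u} {ar : P → ℕ} (M : Model N I P ar) (S : M.W → Prop)
    (hS : ∃ w, S w) : Model N I P ar where
  W := {w // S w}
  D := M.D
  nonempty_W := let ⟨w, hw⟩ := hS; ⟨⟨w, hw⟩⟩
  nonempty_D := M.nonempty_D
  R := fun i v v' => M.R i v.1 v'.1
  ρ := fun p v => M.ρ p v.1
  η := fun a v => M.η a v.1

/-- The value of a term at a world under an assignment. -/
def Term.val {V N I P : Type u} {ar : P → ℕ} (M : Model N I P ar) (w : M.W) (σ : V → M.D) :
    Term V N → M.D
  | .var x => σ x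
  | .name a => M.η a w

/-- Truth of a formula at a pointed model `M, w, σ`. -/
def Sat {V N I P : Type u} {ar : P → ℕ} [DecidableEq V] :
    Formula V N I P ar → (M : Model N I P ar) → M.W → (V → M.D) → Prop
  | .eq t t', M, w, σ => t.val M w σ = t'.val M w σ
  | .pred p ts, M, w, σ => M.ρ p w (fun k => (ts k).val M w σ)
  | .and φ ψ, M, w, σ => Sat φ M w σ ∧ Sat ψ M w σ
  | .neg φ, M, w, σ => ¬ Sat φ M w σ
  | .know i φ, M, w, σ => ∀ v, M.R i w v → Sat φ M v σ
  | .assign x t φ, M, w, σ => Sat φ M w (Function.update σ x (t.val M w σ))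
  | .announce ψ φ, M, w, σ =>
      ∀ h : Sat ψ M w σ, Sat φ (M.restrict (fun v => Sat ψ M v σ) ⟨w, h⟩) ⟨w, h⟩ σ

/-- Validity over arbitrary models. -/
def Valid {V N I P : Type u} {ar : P → ℕ} [DecidableEq V] (φ : Formula V N I P ar) : Prop :=
  ∀ (M : Model N I P ar) (w : M.W) (σ : V → M.D), Sat φ M w σ

open Formula in
/-- The axiom schemas of `SBELAS`. -/
inductive BaseAxiom {V N I P : Type u} {ar : P → ℕ} [DecidableEq V] [Nonempty V] :
    Formula V N I P ar → Prop
  | TAUT (φ) : φ.IsTautology → BaseAxiom φ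
  | DISTK (i φ ψ) : BaseAxiom (imp (know i (imp φ ψ)) (imp (know i φ) (know i ψ)))
  | ID (t) : BaseAxiom (eq t t)
  | SYM (t t') : BaseAxiom (iff (eq t t') (eq t' t))
  | TRANS (t t' t'') : BaseAxiom (imp (and (eq t t') (eq t' t'')) (eq t t''))
  | SUBAS (t t' x φ) : BaseAxiom (imp (eq t t') (iff (assign x t φ) (assign x t' φ)))
  | SUBP (p ts ts') : BaseAxiom
      (imp (conj (List.ofFn fun k => eq (ts k) (ts' k))) (iff (pred p ts) (pred p ts')))
  | RIGIDP (x y i) : BaseAxiom (imp (eq (.var x) (.var y)) (know i (eq (.var x) (.var y))))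
  | RIGIDN (x y i) : BaseAxiom
      (imp (neg (eq (.var x) (.var y))) (know i (neg (eq (.var x) (.var y)))))
  | KAS (x t φ ψ) : BaseAxiom
      (imp (assign x t (imp φ ψ)) (imp (assign x t φ) (assign x t ψ)))
  | DETAS (x t φ) : BaseAxiom (imp (dualAssign x t φ) (assign x t φ))
  | DAS (x t) : BaseAxiom (dualAssign x t top)
  | EFAS (x t) : BaseAxiom (assign x t (eq (.var x) t))
  | SUB2AS (x y φ) : Admissible y x φ → BaseAxiom (imp (subst y x φ) (assign x (.var y) φ))

open Formula in
/-- The reduction axioms for public announcements. -/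
inductive ReductionAxiom {V N I P : Type u} {ar : P → ℕ} [DecidableEq V] :
    Formula V N I P ar → Prop
  | AATOM (ψ p) : p.IsAtomic → ReductionAxiom (iff (announce ψ p) (imp ψ p))
  | ANEG (ψ φ) : ReductionAxiom (iff (announce ψ (neg φ)) (imp ψ (neg (announce ψ φ))))
  | ACON (ψ φ χ) : ReductionAxiom
      (iff (announce ψ (and φ χ)) (and (announce ψ φ) (announce ψ χ)))
  | AK (ψ i φ) : ReductionAxiom
      (iff (announce ψ (know i φ)) (imp ψ (know i (announce ψ φ))))
  | ACOM (ψ χ φ) : ReductionAxiom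
      (iff (announce ψ (announce χ φ)) (announce (and ψ (announce ψ χ)) φ))
  | AASSI (ψ x t φ z) : z ∉ vars (announce ψ (assign x t φ)) → ReductionAxiom
      (iff (announce ψ (assign x t φ))
        (assign z (.var x) (assign x t (announce (subst z x ψ) φ))))

open Formula in
/-- Derivability (without premises) in `SPALAS`. -/
inductive SPALAS {V N I P : Type u} {ar : P → ℕ} [DecidableEq V] [Nonempty V] :
    Formula V N I P ar → Prop
  | base {φ} : BaseAxiom φ → SPALAS φ
  | reduction {φ} : ReductionAxiom φ → SPALAS φ
  | NECK (i) {φ} : SPALAS φ → SPALAS (know i φ)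
  | MP {φ ψ} : SPALAS φ → SPALAS (imp φ ψ) → SPALAS ψ
  | NECAS (x t) {φ ψ} : x ∉ freeVars φ → SPALAS (imp φ ψ) → SPALAS (imp φ (assign x t ψ))

end PALAS

/-!
Completeness is proved by eliminating announcements and then building models from maximal
consistent sets.

*Elimination.* The reduction axioms are sound, so the reduction of a formula to one without
announcements preserves truth as well as provability (`hasReduct`). The reduction proceeds from the
outside, along a complexity measure, so that no congruence rule for announcements is needed: nested
announcements are merged by the composition axiom. Soundness of that axiom and of AASSI rests on
the invariance of truth under bounded morphisms (`sat_boundedMorphism`) and on a substitution lemma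
for new variables (`sat_subst`).

*Assignments.* If `Γ` is maximal consistent, so is `after Γ x t = {φ | [x := t]φ ∈ Γ}`. As
`φ ↔ [x := x]φ` is derivable, `x ≈ y` implies `φ ↔ [x := y]φ` for every `φ`, and by rigidity of
identity between variables, `[x := y]` commutes with `K_i` (`IsMCS.know_mem_after`). Sequences of
assignments of variables thus act as explicit substitutions, and bound variables need not be
renamed.

*Models.* A valid formula has finitely many free variables, assigns finitely many names and has
finite modal depth, so it suffices to realize, for a maximal consistent `Γ`, the formulas that
respect such bounds. This is done by induction on the depth (`IsMCS.exists_model`). Passing from `Γ`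
to `after Γ y a` for a new variable `y` equips each relevant name `a` with a variable that has the
same value (`IsMCS.exists_witnesses`). For each `K_iφ ∉ Γ` there is a maximal consistent set that
omits `φ` and contains what `i` knows; it satisfies the same identities between variables as `Γ`, so
the models obtained for these sets can be placed below a new root, over a common domain in which
the values of the variables are identified (`Successors.glue`). The domain may contain further
objects, as the language has no quantifiers. `Successors.truth_root` is the truth lemma at the root.
-/

namespace PALAS

open Formula

variable {V N I P : Type u} {ar : P → ℕ}

/-! ### Invariance of truth -/

/-- A bounded morphism between Kripke models, given by a map on worlds that satisfies the forth
and back conditions and an injection of the domains that preserves predicates and names. As there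
are no quantifiers, the injection need not be surjective. -/
structure BoundedMorphism (M M' : Model N I P ar) where
  /-- the map on worlds -/
  world : M.W → M'.W
  /-- the map on objects -/
  obj : M.D → M'.D
  obj_injective : Function.Injective obj
  rel_iff : ∀ i w v', M'.R i (world w) v' ↔ ∃ v, M.R i w v ∧ world v = v'
  pred_iff : ∀ p w d, M'.ρ p (world w) (fun k => obj (d k)) ↔ M.ρ p w d
  name_eq : ∀ a w, M'.η a (world w) = obj (M.η a w)

/-- A bounded morphism restricts to submodels whose worlds correspond. -/
def BoundedMorphism.restrict {M M' : Model N I P ar} (f : BoundedMorphism M M')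
    (S : M.W → Prop) (S' : M'.W → Prop) (hS : ∃ w, S w) (hS' : ∃ w, S' w)
    (h : ∀ w, S' (f.world w) ↔ S w) :
    BoundedMorphism (M.restrict S hS) (M'.restrict S' hS') where
  world v := ⟨f.world v.1, (h v.1).2 v.2⟩
  obj := f.obj
  obj_injective := f.obj_injective
  rel_iff := by
    rintro i ⟨w, hw⟩ ⟨v', hv'⟩
    constructor
    · intro hR
      obtain ⟨v, hv, rfl⟩ := (f.rel_iff i w v').1 hR
      exact ⟨⟨v, (h v).1 hv'⟩, hv, rfl⟩
    · rintro ⟨⟨v, hv⟩, hR, he⟩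
      exact (f.rel_iff i w v').2 ⟨v, hR, congrArg Subtype.val he⟩
  pred_iff p w d := f.pred_iff p w.1 d
  name_eq a w := f.name_eq a w.1

theorem Term.val_boundedMorphism {M M' : Model N I P ar} (f : BoundedMorphism M M') (w : M.W)
    {σ : V → M.D} {σ' : V → M'.D} (t : Term V N) (h : ∀ x ∈ t.vars, σ' x = f.obj (σ x)) :
    t.val M' (f.world w) σ' = f.obj (t.val M w σ) := by
  cases t with
  | var x => exact h x rfl
  | name a => exact f.name_eq a w

theorem Formula.freeVars_subset_vars (φ : Formula V N I P ar) : φ.freeVars ⊆ φ.vars := by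
  induction φ with
  | eq t t' => exact subset_rfl
  | pred p ts => exact subset_rfl
  | and φ ψ ihφ ihψ => exact Set.union_subset_union ihφ ihψ
  | neg φ ih => exact ih
  | know i φ ih => exact ih
  | assign x t φ ih =>
    rintro y (⟨hy, -⟩ | hy)
    · exact Or.inr (ih hy)
    · exact Or.inl (Or.inr hy)
  | announce ψ φ ihψ ihφ => exact Set.union_subset_union ihψ ihφ

theorem forall_prop_iff_forall_prop {p p' : Prop} {q : p → Prop} {q' : p' → Prop} (h : p ↔ p')
    (hq : ∀ (a : p) (a' : p'), q a ↔ q' a') : (∀ a, q a) ↔ ∀ a', q' a' :=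
  ⟨fun H a' => (hq (h.2 a') a').1 (H _), fun H a => (hq a (h.1 a)).2 (H _)⟩

variable [DecidableEq V]

/-- Truth is invariant under bounded morphisms and depends on the values of the free variables
only. -/
theorem sat_boundedMorphism (φ : Formula V N I P ar) : ∀ {M M' : Model N I P ar}
    (f : BoundedMorphism M M') (w : M.W) {σ : V → M.D} {σ' : V → M'.D},
    (∀ x ∈ φ.freeVars, σ' x = f.obj (σ x)) → (Sat φ M' (f.world w) σ' ↔ Sat φ M w σ) := by
  induction φ with
  | eq t t' =>
    intro M M' f w σ σ' h
    simp only [Sat]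
    rw [t.val_boundedMorphism f w fun x hx => h x (Or.inl hx),
      t'.val_boundedMorphism f w fun x hx => h x (Or.inr hx)]
    exact f.obj_injective.eq_iff
  | pred p ts =>
    intro M M' f w σ σ' h
    simp only [Sat]
    rw [← f.pred_iff]
    have : (fun k => (ts k).val M' (f.world w) σ') = fun k => f.obj ((ts k).val M w σ) :=
      funext fun k => (ts k).val_boundedMorphism f w fun x hx => h x (Set.mem_iUnion.2 ⟨k, hx⟩)
    rw [this]
  | and φ ψ ihφ ihψ =>
    intro M M' f w σ σ' h
    exact and_congr (ihφ f w fun x hx => h x (Or.inl hx)) (ihψ f w fun x hx => h x (Or.inr hx))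
  | neg φ ih =>
    intro M M' f w σ σ' h
    exact not_congr (ih f w h)
  | know i φ ih =>
    intro M M' f w σ σ' h
    constructor
    · intro hs v hv
      exact (ih f v h).1 (hs _ ((f.rel_iff i w _).2 ⟨v, hv, rfl⟩))
    · intro hs v' hv'
      obtain ⟨v, hv, rfl⟩ := (f.rel_iff i w v').1 hv'
      exact (ih f v h).2 (hs v hv)
  | assign x t φ ih =>
    intro M M' f w σ σ' h
    refine ih f w fun y hy => ?_
    by_cases hyx : y = x
    · subst hyx
      simpa using t.val_boundedMorphism f w fun z hz => h z (Or.inr hz)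
    · simpa [hyx] using h y (Or.inl ⟨hy, hyx⟩)
  | announce ψ φ ihψ ihφ =>
    intro M M' f w σ σ' h
    have hψ : ∀ v, Sat ψ M' (f.world v) σ' ↔ Sat ψ M v σ :=
      fun v => ihψ f v fun x hx => h x (Or.inl hx)
    refine forall_prop_iff_forall_prop (hψ w) fun hw' hw => ?_
    exact ihφ (f.restrict (fun v => Sat ψ M v σ) (fun v => Sat ψ M' v σ') ⟨w, hw⟩ ⟨_, hw'⟩
      hψ) ⟨w, hw⟩ fun x hx => h x (Or.inr hx)

/-- The identity as a bounded morphism. -/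
def BoundedMorphism.refl (M : Model N I P ar) : BoundedMorphism M M where
  world := id
  obj := id
  obj_injective := Function.injective_id
  rel_iff := by simp
  pred_iff _ _ _ := Iff.rfl
  name_eq _ _ := rfl

theorem sat_congr {φ : Formula V N I P ar} {M : Model N I P ar} (w : M.W) {σ σ' : V → M.D}
    (h : ∀ x ∈ φ.freeVars, σ' x = σ x) : Sat φ M w σ' ↔ Sat φ M w σ :=
  sat_boundedMorphism φ (BoundedMorphism.refl M) w h

theorem sat_restrict_congr {φ : Formula V N I P ar} {M : Model N I P ar} {S S' : M.W → Prop}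
    (h : ∀ v, S v ↔ S' v) {w : M.W} (hw : S w) (hw' : S' w) (σ : V → M.D) :
    Sat φ (M.restrict S ⟨w, hw⟩) ⟨w, hw⟩ σ ↔ Sat φ (M.restrict S' ⟨w, hw'⟩) ⟨w, hw'⟩ σ := by
  obtain rfl : S = S' := funext fun v => propext (h v)
  exact Iff.rfl

theorem Term.val_subst (M : Model N I P ar) (w : M.W) (σ : V → M.D) (x z : V) (t : Term V N) :
    (t.subst z x).val M w σ = t.val M w (Function.update σ x (σ z)) := by
  cases t with
  | var v => by_cases h : v = x <;> simp [Term.subst, Term.val, h]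
  | name a => rfl

/-- The substitution lemma. With `z` new, no bound variable captures it. -/
theorem sat_subst (φ : Formula V N I P ar) {x z : V} : z ∉ φ.vars →
    ∀ (M : Model N I P ar) (w : M.W) (σ : V → M.D),
      Sat (subst z x φ) M w σ ↔ Sat φ M w (Function.update σ x (σ z)) := by
  induction φ with
  | eq t t' => intro _ M w σ; simp only [Formula.subst, Sat, Term.val_subst]
  | pred p ts => intro _ M w σ; simp only [Formula.subst, Sat, Term.val_subst]
  | and φ ψ ihφ ihψ =>
    intro hz M w σ
    exact and_congr (ihφ (fun h => hz (Or.inl h)) M w σ) (ihψ (fun h => hz (Or.inr h)) M w σ)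
  | neg φ ih => intro hz M w σ; exact not_congr (ih hz M w σ)
  | know i φ ih => intro hz M w σ; exact forall₂_congr fun v _ => ih hz M v σ
  | assign v t φ ih =>
    intro hz M w σ
    have hzv : z ≠ v := fun h => hz (Or.inl (Or.inl h))
    by_cases hv : v = x
    · subst hv
      simp only [Formula.subst, Sat, Term.val_subst, if_true, Function.update_idem]
    · simp only [Formula.subst, Sat, Term.val_subst, if_neg hv]
      rw [ih (fun h => hz (Or.inr h)), Function.update_of_ne hzv, Function.update_comm hv]
  | announce ψ φ ihψ ihφ =>
    intro hz M w σ
    have hψ := fun v => ihψ (fun h => hz (Or.inl h)) M v σ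
    refine forall_prop_iff_forall_prop (hψ w) fun hw' hw => ?_
    exact (sat_restrict_congr hψ hw' hw σ).trans (ihφ (fun h => hz (Or.inr h))
      (M.restrict (fun v => Sat ψ M v (Function.update σ x (σ z))) ⟨w, hw⟩) ⟨w, hw⟩ σ)

/-! ### Soundness of the reduction axioms -/

theorem sat_imp {φ ψ : Formula V N I P ar} {M : Model N I P ar} {w : M.W} {σ : V → M.D} :
    Sat (imp φ ψ) M w σ ↔ (Sat φ M w σ → Sat ψ M w σ) := by
  simp only [imp, Sat]
  tauto

theorem sat_announce_atomic {ψ p : Formula V N I P ar} (hp : p.IsAtomic) {M : Model N I P ar}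
    {w : M.W} {σ : V → M.D} : Sat (announce ψ p) M w σ ↔ Sat (imp ψ p) M w σ := by
  rw [sat_imp]
  cases p with
  | eq t t' => cases t <;> cases t' <;> exact Iff.rfl
  | pred p ts =>
    have h (h : Sat ψ M w σ) (k) : (ts k).val (M.restrict (fun v => Sat ψ M v σ) ⟨w, h⟩) ⟨w, h⟩ σ =
        (ts k).val M w σ := by cases ts k <;> rfl
    simp only [Sat, h]
  | _ => exact hp.elim

theorem sat_announce_neg {ψ φ : Formula V N I P ar} {M : Model N I P ar} {w : M.W} {σ : V → M.D} :
    Sat (announce ψ (neg φ)) M w σ ↔ Sat (imp ψ (neg (announce ψ φ))) M w σ := by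
  rw [sat_imp]
  exact forall_congr' fun h => ⟨fun hn ha => hn (ha h), fun hn ha => hn fun _ => ha⟩

theorem sat_announce_and {ψ φ χ : Formula V N I P ar} {M : Model N I P ar} {w : M.W}
    {σ : V → M.D} :
    Sat (announce ψ (and φ χ)) M w σ ↔ Sat (and (announce ψ φ) (announce ψ χ)) M w σ :=
  forall_and

theorem sat_announce_know {ψ φ : Formula V N I P ar} {i : I} {M : Model N I P ar} {w : M.W}
    {σ : V → M.D} :
    Sat (announce ψ (know i φ)) M w σ ↔ Sat (imp ψ (know i (announce ψ φ))) M w σ := by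
  rw [sat_imp]
  exact forall_congr' fun h => ⟨fun hk v hv hψ => hk ⟨v, hψ⟩ hv, fun hk v hv => hk v.1 hv v.2⟩

theorem sat_announce_announce {ψ χ φ : Formula V N I P ar} {M : Model N I P ar} {w : M.W}
    {σ : V → M.D} :
    Sat (announce ψ (announce χ φ)) M w σ ↔ Sat (announce (and ψ (announce ψ χ)) φ) M w σ := by
  -- the two iterated restrictions have the same worlds, up to the nesting of subtypes
  have key (h : Sat ψ M w σ)
      (h' : Sat χ (M.restrict (fun v => Sat ψ M v σ) ⟨w, h⟩) ⟨w, h⟩ σ) :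
      Sat φ (M.restrict (fun v => Sat (and ψ (announce ψ χ)) M v σ) ⟨w, h, fun _ => h'⟩)
        ⟨w, h, fun _ => h'⟩ σ ↔
      Sat φ ((M.restrict (fun v => Sat ψ M v σ) ⟨w, h⟩).restrict
        (fun v => Sat χ (M.restrict (fun v => Sat ψ M v σ) ⟨w, h⟩) v σ) ⟨⟨w, h⟩, h'⟩)
        ⟨⟨w, h⟩, h'⟩ σ := by
    let f : BoundedMorphism ((M.restrict (fun v => Sat ψ M v σ) ⟨w, h⟩).restrict
        (fun v => Sat χ (M.restrict (fun v => Sat ψ M v σ) ⟨w, h⟩) v σ) ⟨⟨w, h⟩, h'⟩)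
        (M.restrict (fun v => Sat (and ψ (announce ψ χ)) M v σ) ⟨w, h, fun _ => h'⟩) :=
      { world := fun v => ⟨v.1.1, v.1.2, fun _ => v.2⟩
        obj := id
        obj_injective := Function.injective_id
        rel_iff := by
          rintro i ⟨⟨w, _⟩, _⟩ ⟨v, hv, hv'⟩
          constructor
          · exact fun hR => ⟨⟨⟨v, hv⟩, hv' hv⟩, hR, rfl⟩
          · rintro ⟨⟨⟨u, _⟩, _⟩, hR, he⟩
            obtain rfl : u = v := congrArg Subtype.val he
            exact hR
        pred_iff := fun _ _ _ => Iff.rfl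
        name_eq := fun _ _ => rfl }
    exact sat_boundedMorphism φ f ⟨⟨w, h⟩, h'⟩ fun _ _ => rfl
  constructor
  · intro hs h
    exact (key h.1 (h.2 h.1)).2 (hs h.1 (h.2 h.1))
  · intro hs h h'
    exact (key h h').1 (hs ⟨h, fun _ => h'⟩)

theorem sat_announce_assign {ψ φ : Formula V N I P ar} {x z : V} {t : Term V N}
    (hz : z ∉ vars (announce ψ (assign x t φ))) {M : Model N I P ar} {w : M.W} {σ : V → M.D} :
    Sat (announce ψ (assign x t φ)) M w σ ↔
      Sat (assign z (.var x) (assign x t (announce (subst z x ψ) φ))) M w σ := by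
  have hzψ : z ∉ ψ.vars := fun h => hz (Or.inl h)
  have hzx : z ≠ x := fun h => hz (Or.inr (Or.inl (Or.inl h)))
  have hzt : z ∉ t.vars := fun h => hz (Or.inr (Or.inl (Or.inr h)))
  have hzφ : z ∉ φ.vars := fun h => hz (Or.inr (Or.inr h))
  have hval : t.val M w (Function.update σ z (σ x)) = t.val M w σ := by
    cases t with
    | var v => exact Function.update_of_ne (fun h => hzt h.symm) _ _
    | name a => rfl
  have hψ (v : M.W) : Sat (subst z x ψ) M v
      (Function.update (Function.update σ z (σ x)) x (t.val M w σ)) ↔ Sat ψ M v σ := by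
    rw [sat_subst ψ hzψ]
    refine sat_congr v fun y hy => ?_
    have hyz : y ≠ z := fun h => hzψ (h ▸ ψ.freeVars_subset_vars hy)
    by_cases hyx : y = x
    · subst hyx; simp [hzx]
    · simp [hyx, hyz]
  have hrhs : Sat (assign z (.var x) (assign x t (announce (subst z x ψ) φ))) M w σ ↔
      Sat (announce (subst z x ψ) φ) M w
        (Function.update (Function.update σ z (σ x)) x (t.val M w σ)) := by
    rw [← hval]; exact Iff.rfl
  rw [hrhs]
  refine (forall_prop_iff_forall_prop (hψ w) fun hw' hw => ?_).symm
  refine (sat_restrict_congr hψ hw' hw _).trans ?_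
  have hval' : t.val (M.restrict (fun v => Sat ψ M v σ) ⟨w, hw⟩) ⟨w, hw⟩ σ = t.val M w σ := by
    cases t <;> rfl
  simp only [Sat, hval']
  refine sat_congr _ fun y hy => ?_
  have hyz : y ≠ z := fun h => hzφ (h ▸ φ.freeVars_subset_vars hy)
  by_cases hyx : y = x
  · subst hyx; simp
  · simp [hyx, hyz]

/-! ### Maximal consistent sets -/

omit [DecidableEq V] in
theorem val_imp {v : Formula V N I P ar → Prop} (hn : ∀ χ, v (neg χ) ↔ ¬ v χ)
    (ha : ∀ χ ξ, v (and χ ξ) ↔ v χ ∧ v ξ) (φ ψ : Formula V N I P ar) :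
    v (imp φ ψ) ↔ (v φ → v ψ) := by
  simp only [imp, hn, ha]
  tauto

theorem Formula.subst_self (x : V) (φ : Formula V N I P ar) : subst x x φ = φ := by
  have ht (t : Term V N) : t.subst x x = t := by
    cases t with
    | var v => by_cases h : v = x <;> simp [Term.subst, h]
    | name a => rfl
  induction φ <;> simp_all [subst]

theorem Formula.admissible_self (x : V) (φ : Formula V N I P ar) :
    Admissible x x φ := by
  induction φ with
  | assign v t φ ih => by_cases h : v = x <;> simp_all [Admissible]
  | _ => simp_all [Admissible]

variable [Infinite V]

/-- `Ded S φ`: `φ` follows from theorems of `SPALAS` and members of `S` by modus ponens. -/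
inductive Ded (S : Set (Formula V N I P ar)) : Formula V N I P ar → Prop
  | hyp {φ} : φ ∈ S → Ded S φ
  | thm {φ} : SPALAS φ → Ded S φ
  | mp {φ ψ} : Ded S φ → Ded S (imp φ ψ) → Ded S ψ

theorem SPALAS.taut {φ : Formula V N I P ar} (h : φ.IsTautology) : SPALAS φ := .base (.TAUT φ h)

theorem Ded.mono {S T : Set (Formula V N I P ar)} (h : S ⊆ T) {φ : Formula V N I P ar}
    (hd : Ded S φ) : Ded T φ := by
  induction hd with
  | hyp hφ => exact .hyp (h hφ)
  | thm hφ => exact .thm hφ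
  | mp _ _ ih₁ ih₂ => exact .mp ih₁ ih₂

/-- The deduction theorem. -/
theorem Ded.imp_of_insert {S : Set (Formula V N I P ar)} {χ φ : Formula V N I P ar}
    (h : Ded (insert χ S) φ) : Ded S (imp χ φ) := by
  have weaken {φ} (h : Ded S φ) : Ded S (imp χ φ) :=
    .mp h (.thm (.taut fun v hn ha => by simp only [val_imp hn ha]; tauto))
  induction h with
  | hyp hφ =>
    rcases hφ with rfl | hφ
    · exact .thm (.taut fun v hn ha => by simp only [val_imp hn ha]; tauto)
    · exact weaken (.hyp hφ)
  | thm hφ => exact weaken (.thm hφ)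
  | @mp φ ψ _ _ ih₁ ih₂ =>
    exact .mp ih₁ (.mp ih₂ (.thm (.taut fun v hn ha => by simp only [val_imp hn ha]; tauto)))

theorem Ded.spalas {φ : Formula V N I P ar} (h : Ded ∅ φ) : SPALAS φ := by
  induction h with
  | hyp hφ => exact hφ.elim
  | thm hφ => exact hφ
  | mp _ _ ih₁ ih₂ => exact .MP ih₁ ih₂

theorem Ded.exists_of_sUnion {c : Set (Set (Formula V N I P ar))} (hc : IsChain (· ⊆ ·) c)
    (hne : c.Nonempty) {φ : Formula V N I P ar} (h : Ded (⋃₀ c) φ) : ∃ S ∈ c, Ded S φ := by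
  induction h with
  | hyp hφ =>
    obtain ⟨S, hS, hφ⟩ := hφ
    exact ⟨S, hS, .hyp hφ⟩
  | thm hφ => exact ⟨_, hne.some_mem, .thm hφ⟩
  | mp _ _ ih₁ ih₂ =>
    obtain ⟨S, hS, h₁⟩ := ih₁
    obtain ⟨T, hT, h₂⟩ := ih₂
    rcases hc.total hS hT with hST | hTS
    · exact ⟨T, hT, .mp (h₁.mono hST) h₂⟩
    · exact ⟨S, hS, .mp h₁ (h₂.mono hTS)⟩

/-- Maximal consistent sets of formulas: sets that contain the theorems, are closed under modus
ponens, and contain exactly one of `φ` and `¬φ` for each `φ`. -/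
structure IsMCS (Γ : Set (Formula V N I P ar)) : Prop where
  thm : ∀ {φ}, SPALAS φ → φ ∈ Γ
  mp : ∀ {φ ψ}, imp φ ψ ∈ Γ → φ ∈ Γ → ψ ∈ Γ
  neg_mem : ∀ {φ}, neg φ ∈ Γ ↔ φ ∉ Γ

/-- Lindenbaum's lemma. -/
theorem exists_isMCS_of_not_ded {S : Set (Formula V N I P ar)} {φ : Formula V N I P ar}
    (h : ¬ Ded S φ) : ∃ Γ, S ⊆ Γ ∧ IsMCS Γ ∧ φ ∉ Γ := by
  obtain ⟨Γ, hSΓ, hmax⟩ := zorn_subset_nonempty {T | ¬ Ded T φ}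
    (fun c hc hchain hne => ⟨⋃₀ c, fun hd => by
      obtain ⟨T, hT, hd⟩ := hd.exists_of_sUnion hchain hne
      exact hc hT hd, fun T hT => Set.subset_sUnion_of_mem hT⟩) S h
  have hΓ : ¬ Ded Γ φ := hmax.prop
  have him {ψ} (hψ : ψ ∉ Γ) : Ded Γ (imp ψ φ) := by
    refine Ded.imp_of_insert (by_contra fun hd => hψ ?_)
    exact hmax.le_of_ge (y := insert ψ Γ) hd (Set.subset_insert _ _) (Set.mem_insert _ _)
  have hded {ψ} (hd : Ded Γ ψ) : ψ ∈ Γ := by_contra fun hψ => hΓ (.mp hd (him hψ))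
  refine ⟨Γ, hSΓ, ⟨fun h => hded (.thm h), fun h₁ h₂ => hded (.mp (.hyp h₂) (.hyp h₁)), ?_⟩,
    fun h => hΓ (.hyp h)⟩
  intro ψ
  constructor
  · intro hn hp
    refine hΓ (.mp (.hyp hp) (.mp (.hyp hn) (.thm (.taut fun v hn ha => ?_))))
    simp only [val_imp hn ha, hn]
    tauto
  · refine fun hp => by_contra fun hn => hΓ ?_
    refine .mp (him hn) (.mp (him hp) (.thm (.taut fun v hn ha => ?_)))
    simp only [val_imp hn ha, hn]
    tauto

theorem spalas_of_forall_isMCS {φ : Formula V N I P ar} (h : ∀ Γ, IsMCS Γ → φ ∈ Γ) :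
    SPALAS φ := by
  by_contra hφ
  obtain ⟨Γ, -, hΓ, hφΓ⟩ := exists_isMCS_of_not_ded (S := ∅) fun hd : Ded ∅ φ => hφ hd.spalas
  exact hφΓ (h Γ hΓ)

/-- The set of formulas that hold after the assignment `[x := t]`, according to `Γ`. -/
def after (Γ : Set (Formula V N I P ar)) (x : V) (t : Term V N) : Set (Formula V N I P ar) :=
  {φ | assign x t φ ∈ Γ}

namespace IsMCS

variable {Γ : Set (Formula V N I P ar)} (hΓ : IsMCS Γ)
include hΓ

theorem and_mem {φ ψ : Formula V N I P ar} : and φ ψ ∈ Γ ↔ φ ∈ Γ ∧ ψ ∈ Γ := by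
  constructor
  · intro h
    constructor <;> refine hΓ.mp (hΓ.thm (.taut fun v hn ha => ?_)) h <;>
      simp only [val_imp hn ha, ha] <;> tauto
  · rintro ⟨h₁, h₂⟩
    refine hΓ.mp (hΓ.mp (hΓ.thm (.taut fun v hn ha => ?_)) h₁) h₂
    simp only [val_imp hn ha, ha]
    tauto

theorem imp_mem {φ ψ : Formula V N I P ar} : imp φ ψ ∈ Γ ↔ (φ ∈ Γ → ψ ∈ Γ) :=
  val_imp (v := (· ∈ Γ)) (fun _ => hΓ.neg_mem) (fun _ _ => hΓ.and_mem) φ ψ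

theorem iff_mem {φ ψ : Formula V N I P ar} : Formula.iff φ ψ ∈ Γ ↔ (φ ∈ Γ ↔ ψ ∈ Γ) := by
  rw [Formula.iff, hΓ.and_mem, hΓ.imp_mem, hΓ.imp_mem]
  exact iff_iff_implies_and_implies.symm

theorem top_mem : top ∈ Γ := hΓ.imp_mem.2 id

theorem conj_mem {l : List (Formula V N I P ar)} : conj l ∈ Γ ↔ ∀ φ ∈ l, φ ∈ Γ := by
  induction l with
  | nil => simpa [conj] using hΓ.top_mem
  | cons φ l ih => simp [conj, hΓ.and_mem, ih]

theorem base {φ : Formula V N I P ar} (h : BaseAxiom φ) : φ ∈ Γ := hΓ.thm (.base h)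

theorem eq_refl (t : Term V N) : eq t t ∈ Γ := hΓ.base (.ID t)

theorem eq_symm {t t' : Term V N} (h : eq t t' ∈ Γ) : eq t' t ∈ Γ :=
  (hΓ.iff_mem.1 (hΓ.base (.SYM t t'))).1 h

theorem eq_trans {t t' t'' : Term V N} (h : eq t t' ∈ Γ) (h' : eq t' t'' ∈ Γ) : eq t t'' ∈ Γ :=
  hΓ.imp_mem.1 (hΓ.base (.TRANS t t' t'')) (hΓ.and_mem.2 ⟨h, h'⟩)

theorem pred_mem_of_eq {p : P} {ts ts' : Fin (ar p) → Term V N} (h : ∀ k, eq (ts k) (ts' k) ∈ Γ)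
    (hp : pred p ts ∈ Γ) : pred p ts' ∈ Γ := by
  refine (hΓ.iff_mem.1 (hΓ.imp_mem.1 (hΓ.base (.SUBP p ts ts')) (hΓ.conj_mem.2 ?_))).1 hp
  intro φ hφ
  obtain ⟨k, rfl⟩ := List.mem_ofFn.1 hφ
  exact h k

theorem know_mem_of_imp {i : I} {φ ψ : Formula V N I P ar} (h : know i (imp φ ψ) ∈ Γ)
    (hφ : know i φ ∈ Γ) : know i ψ ∈ Γ :=
  hΓ.imp_mem.1 (hΓ.imp_mem.1 (hΓ.base (.DISTK i φ ψ)) h) hφ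

/-- Knowledge is closed under deduction. -/
theorem know_mem_of_ded {i : I} {φ : Formula V N I P ar} (h : Ded {χ | know i χ ∈ Γ} φ) :
    know i φ ∈ Γ := by
  induction h with
  | hyp hφ => exact hφ
  | thm hφ => exact hΓ.thm (.NECK i hφ)
  | mp _ _ ih₁ ih₂ => exact hΓ.know_mem_of_imp ih₂ ih₁

/-- A formula that is not known fails in a maximal consistent set of epistemic alternatives. -/
theorem exists_successor {i : I} {φ : Formula V N I P ar} (h : know i φ ∉ Γ) :
    ∃ Δ, IsMCS Δ ∧ (∀ χ, know i χ ∈ Γ → χ ∈ Δ) ∧ φ ∉ Δ := by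
  obtain ⟨Δ, hsub, hΔ, hφ⟩ := exists_isMCS_of_not_ded fun hd => h (hΓ.know_mem_of_ded hd)
  exact ⟨Δ, hΔ, fun χ hχ => hsub hχ, hφ⟩

/-- Identity between variables is rigid. -/
theorem var_eq_mem_successor {i : I} {Δ : Set (Formula V N I P ar)} (hΔ : IsMCS Δ)
    (h : ∀ χ, know i χ ∈ Γ → χ ∈ Δ) {x y : V} :
    eq (.var x) (.var y) ∈ Δ ↔ eq (.var x) (.var y) ∈ Γ := by
  refine ⟨fun hd => by_contra fun hn => ?_,
    fun hg => h _ (hΓ.imp_mem.1 (hΓ.base (.RIGIDP x y i)) hg)⟩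
  exact hΔ.neg_mem.1 (h _ (hΓ.imp_mem.1 (hΓ.base (.RIGIDN x y i)) (hΓ.neg_mem.2 hn))) hd

/-! ### Assignments and maximal consistent sets -/

theorem after_isMCS (x : V) (t : Term V N) : IsMCS (after Γ x t) := by
  have thm {φ : Formula V N I P ar} (h : SPALAS φ) : assign x t φ ∈ Γ := by
    -- the premise of the rule for assignments is a theorem in which `x` is not free
    obtain ⟨y, hy⟩ := exists_ne x
    refine hΓ.mp (hΓ.thm (.NECAS x t (φ := eq (.var y) (.var y)) ?_ ?_)) (hΓ.eq_refl _)
    · simp [freeVars, Term.vars, hy.symm]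
    · exact .MP h (.taut fun v hn ha => by simp only [val_imp hn ha]; tauto)
  have mp {φ ψ : Formula V N I P ar} (h : assign x t (imp φ ψ) ∈ Γ) (hφ : assign x t φ ∈ Γ) :
      assign x t ψ ∈ Γ := hΓ.imp_mem.1 (hΓ.imp_mem.1 (hΓ.base (.KAS x t φ ψ)) h) hφ
  refine ⟨thm, mp, ?_⟩
  intro φ
  constructor
  · intro hn hp
    refine hΓ.neg_mem.1 (hΓ.base (.DAS x t)) (mp (mp (thm (.taut fun v hn ha => ?_)) hn) hp)
    simp only [val_imp hn ha, hn]
    tauto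
  · intro hp
    by_contra hn
    exact hp (hΓ.imp_mem.1 (hΓ.base (.DETAS x t φ)) (hΓ.neg_mem.2 hn))

theorem mem_after_of_notMem_freeVars {x : V} {t : Term V N} {φ : Formula V N I P ar}
    (hx : x ∉ φ.freeVars) : φ ∈ after Γ x t ↔ φ ∈ Γ := by
  have key {ψ : Formula V N I P ar} (hx : x ∉ ψ.freeVars) (h : ψ ∈ Γ) : ψ ∈ after Γ x t :=
    hΓ.mp (hΓ.thm (.NECAS x t hx
      (.taut fun v hn ha => by simp only [val_imp hn ha]; tauto))) h
  refine ⟨fun h => by_contra fun hn => ?_, key hx⟩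
  exact (hΓ.after_isMCS x t).neg_mem.1 (key (ψ := neg φ) hx (hΓ.neg_mem.2 hn)) h

/-- If substitution of `y` for `x` is admissible in `φ`, then `[x := y]φ` amounts to the
substitution. -/
theorem mem_after_iff_subst_mem {x y : V} {φ : Formula V N I P ar} (h : Admissible y x φ) :
    φ ∈ after Γ x (.var y) ↔ subst y x φ ∈ Γ := by
  refine ⟨fun ha => by_contra fun hn => ?_, hΓ.imp_mem.1 (hΓ.base (.SUB2AS x y φ h))⟩
  refine (hΓ.after_isMCS x (.var y)).neg_mem.1 (hΓ.imp_mem.1 (hΓ.base (.SUB2AS x y (neg φ) h)) ?_) ha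
  exact hΓ.neg_mem.2 hn

theorem after_congr {x : V} {t t' : Term V N} (h : eq t t' ∈ Γ) :
    after Γ x t = after Γ x t' :=
  Set.ext fun φ => hΓ.iff_mem.1 (hΓ.imp_mem.1 (hΓ.base (.SUBAS t t' x φ)) h)

/-- Assigning to `x` the value that it has already changes nothing. -/
theorem after_eq_self {x : V} {t : Term V N} (h : eq (.var x) t ∈ Γ) : after Γ x t = Γ := by
  rw [← hΓ.after_congr h]
  ext φ
  rw [hΓ.mem_after_iff_subst_mem (φ.admissible_self x), φ.subst_self]

theorem eq_mem_after (x : V) (t : Term V N) : eq (.var x) t ∈ after Γ x t :=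
  hΓ.base (.EFAS x t)

/-- Assignment of a variable commutes with knowledge. For distinct `x` and `y`, the identity
`x ≈ y` is known after `[x := y]`, and it makes `φ` and `[x := y]φ` equivalent. -/
theorem know_mem_after {x y : V} {i : I} {φ : Formula V N I P ar} :
    know i φ ∈ after Γ x (.var y) ↔ know i (assign x (.var y) φ) ∈ Γ := by
  have hthm : SPALAS (imp (eq (.var x) (.var y)) (Formula.iff φ (assign x (.var y) φ))) := by
    refine spalas_of_forall_isMCS fun Δ hΔ => hΔ.imp_mem.2 fun he => hΔ.iff_mem.2 ?_
    conv_lhs => rw [← hΔ.after_eq_self he]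
    exact Iff.rfl
  have key {Δ : Set (Formula V N I P ar)} (hΔ : IsMCS Δ) (he : eq (.var x) (.var y) ∈ Δ) :
      know i φ ∈ Δ ↔ know i (assign x (.var y) φ) ∈ Δ := by
    have h₁ := hΔ.know_mem_of_imp (hΔ.thm (.NECK i hthm))
      (hΔ.imp_mem.1 (hΔ.base (.RIGIDP x y i)) he)
    constructor <;> refine fun h => hΔ.know_mem_of_imp (hΔ.know_mem_of_imp
      (hΔ.thm (.NECK i (.taut fun v hn ha => ?_))) h₁) h <;>
      simp only [val_imp hn ha, Formula.iff, ha] <;> tauto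
  rw [key (hΓ.after_isMCS x (.var y)) (hΓ.eq_mem_after x _)]
  by_cases hxy : x = y
  · subst hxy
    rw [hΓ.after_eq_self (hΓ.eq_refl _)]
  · exact hΓ.mem_after_of_notMem_freeVars (by simp [freeVars, Term.vars, hxy])

end IsMCS

/-! ### Elimination of announcements -/

/-- `Basic A φ n`: the formula `φ` contains no announcement, has modal depth at most `n`, and
every name that it assigns to a variable is in `A`. -/
def Basic (A : Set N) : Formula V N I P ar → ℕ → Prop
  | eq _ _, _ => True
  | pred _ _, _ => True
  | .and φ ψ, n => Basic A φ n ∧ Basic A ψ n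
  | neg φ, n => Basic A φ n
  | know _ _, 0 => False
  | know _ φ, n + 1 => Basic A φ n
  | assign _ t φ, n => (∀ a, t = .name a → a ∈ A) ∧ Basic A φ n
  | announce _ _, _ => False

omit [DecidableEq V] [Infinite V] in
theorem Basic.mono {A B : Set N} (hAB : A ⊆ B) {φ : Formula V N I P ar} {m n : ℕ} (hmn : m ≤ n)
    (h : Basic A φ m) : Basic B φ n := by
  induction φ generalizing m n with
  | eq t t' => trivial
  | pred p ts => trivial
  | and φ ψ ihφ ihψ => exact ⟨ihφ hmn h.1, ihψ hmn h.2⟩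
  | neg φ ih => exact ih (m := m) hmn h
  | know i φ ih =>
    obtain _ | m := m
    · exact h.elim
    obtain _ | n := n
    · omega
    exact ih (m := m) (n := n) (by omega) h
  | assign x t φ ih => exact ⟨fun a ha => hAB (h.1 a ha), ih hmn h.2⟩
  | announce ψ φ => exact h.elim

/-- Equivalence of formulas, both semantic and derivable in `SPALAS`. Derivability is expressed by
membership in all maximal consistent sets (`spalas_of_forall_isMCS`). -/
structure Equivalent (φ ψ : Formula V N I P ar) : Prop where
  mem_iff : ∀ {Γ}, IsMCS Γ → (φ ∈ Γ ↔ ψ ∈ Γ)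
  sat_iff : ∀ {M : Model N I P ar} {w : M.W} {σ : V → M.D}, Sat φ M w σ ↔ Sat ψ M w σ

namespace Equivalent

variable {φ φ' ψ ψ' χ : Formula V N I P ar}

theorem of_reductionAxiom (h : ReductionAxiom (Formula.iff φ ψ))
    (hs : ∀ {M : Model N I P ar} {w : M.W} {σ : V → M.D}, Sat φ M w σ ↔ Sat ψ M w σ) :
    Equivalent φ ψ :=
  ⟨fun hΓ => hΓ.iff_mem.1 (hΓ.thm (.reduction h)), hs⟩

theorem refl (φ : Formula V N I P ar) : Equivalent φ φ := ⟨fun _ => Iff.rfl, Iff.rfl⟩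

theorem trans (h : Equivalent φ ψ) (h' : Equivalent ψ χ) : Equivalent φ χ :=
  ⟨fun hΓ => (h.mem_iff hΓ).trans (h'.mem_iff hΓ), h.sat_iff.trans h'.sat_iff⟩

theorem neg (h : Equivalent φ φ') : Equivalent (neg φ) (neg φ') :=
  ⟨fun hΓ => by rw [hΓ.neg_mem, hΓ.neg_mem, h.mem_iff hΓ], not_congr h.sat_iff⟩

theorem and (h : Equivalent φ φ') (h' : Equivalent ψ ψ') : Equivalent (and φ ψ) (and φ' ψ') :=
  ⟨fun hΓ => by rw [hΓ.and_mem, hΓ.and_mem, h.mem_iff hΓ, h'.mem_iff hΓ],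
    and_congr h.sat_iff h'.sat_iff⟩

theorem know (i : I) (h : Equivalent φ φ') : Equivalent (know i φ) (know i φ') := by
  have key {φ ψ : Formula V N I P ar} (h : ∀ Γ, IsMCS Γ → φ ∈ Γ → ψ ∈ Γ)
      {Γ : Set (Formula V N I P ar)} (hΓ : IsMCS Γ) (hφ : Formula.know i φ ∈ Γ) :
      Formula.know i ψ ∈ Γ :=
    hΓ.know_mem_of_imp
      (hΓ.thm (.NECK i (spalas_of_forall_isMCS fun Δ hΔ => hΔ.imp_mem.2 (h Δ hΔ)))) hφ
  exact ⟨fun hΓ => ⟨key (fun _ hΔ => (h.mem_iff hΔ).1) hΓ, key (fun _ hΔ => (h.mem_iff hΔ).2) hΓ⟩,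
    forall₂_congr fun _ _ => h.sat_iff⟩

theorem assign (x : V) (t : Term V N) (h : Equivalent φ φ') :
    Equivalent (assign x t φ) (assign x t φ') :=
  ⟨fun hΓ => h.mem_iff (hΓ.after_isMCS x t), h.sat_iff⟩

end Equivalent

/-- `φ` is equivalent to a formula without announcements. -/
def HasReduct (φ : Formula V N I P ar) : Prop :=
  ∃ (φ' : Formula V N I P ar) (A : Set N) (n : ℕ), A.Finite ∧ Basic A φ' n ∧ Equivalent φ φ'

namespace HasReduct

variable {φ ψ : Formula V N I P ar}

theorem of_equivalent (h : Equivalent φ ψ) : HasReduct ψ → HasReduct φ :=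
  fun ⟨ψ', A, n, hA, hb, he⟩ => ⟨ψ', A, n, hA, hb, h.trans he⟩

theorem atomic (h : φ.IsAtomic) : HasReduct φ := by
  refine ⟨φ, ∅, 0, Set.finite_empty, ?_, .refl φ⟩
  cases φ <;> trivial

theorem neg : HasReduct φ → HasReduct (neg φ) :=
  fun ⟨φ', A, n, hA, hb, he⟩ => ⟨.neg φ', A, n, hA, hb, he.neg⟩

theorem and : HasReduct φ → HasReduct ψ → HasReduct (and φ ψ) :=
  fun ⟨φ', A, m, hA, hb, he⟩ ⟨ψ', B, n, hB, hb', he'⟩ =>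
    ⟨.and φ' ψ', A ∪ B, max m n, hA.union hB, ⟨hb.mono Set.subset_union_left (le_max_left _ _),
      hb'.mono Set.subset_union_right (le_max_right _ _)⟩, he.and he'⟩

theorem imp (h : HasReduct φ) (h' : HasReduct ψ) : HasReduct (imp φ ψ) := (h.and h'.neg).neg

theorem know (i : I) : HasReduct φ → HasReduct (know i φ) :=
  fun ⟨φ', A, n, hA, hb, he⟩ => ⟨.know i φ', A, n + 1, hA, hb, he.know i⟩

theorem assign (x : V) (t : Term V N) : HasReduct φ → HasReduct (assign x t φ) := by
  rintro ⟨φ', A, n, hA, hb, he⟩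
  refine ⟨.assign x t φ', A ∪ {a | t = .name a}, n, hA.union (Set.Subsingleton.finite ?_),
    ⟨fun a ha => Or.inr ha, hb.mono Set.subset_union_left le_rfl⟩, he.assign x t⟩
  rintro a rfl b hb
  exact Term.name.inj hb

end HasReduct

/-- A measure of formulas for which the right-hand sides of the reduction axioms are simpler than
the left-hand sides. The constant `5` outweighs the connectives that the axioms for `¬` and `K_i`
introduce, where `→` is defined by `¬` and `∧`. -/
def Formula.complexity : Formula V N I P ar → ℕ
  | eq _ _ => 1
  | pred _ _ => 1
  | and φ ψ => 1 + complexity φ + complexity ψ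
  | neg φ => 1 + complexity φ
  | know _ φ => 1 + complexity φ
  | assign _ _ φ => 1 + complexity φ
  | announce ψ φ => (5 + complexity ψ) * complexity φ

omit [DecidableEq V] [Infinite V] in
theorem Formula.complexity_pos (φ : Formula V N I P ar) : 0 < φ.complexity := by
  induction φ <;> simp_all [complexity]

omit [Infinite V] in
theorem Formula.complexity_subst (x z : V) (φ : Formula V N I P ar) :
    (subst z x φ).complexity = φ.complexity := by
  induction φ with
  | assign v t φ ih => by_cases h : v = x <;> simp_all [subst, complexity]
  | _ => simp_all [subst, complexity]

omit [DecidableEq V] [Infinite V] in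
theorem Term.finite_vars (t : Term V N) : t.vars.Finite := by
  cases t <;> simp [Term.vars]

omit [DecidableEq V] [Infinite V] in
theorem Formula.finite_vars (φ : Formula V N I P ar) : φ.vars.Finite := by
  induction φ <;> simp_all [vars, Term.finite_vars, Set.finite_iUnion]

theorem hasReduct (φ : Formula V N I P ar) : HasReduct φ := by
  induction h : φ.complexity using Nat.strong_induction_on generalizing φ with
  | _ n ih =>
    subst h
    have ih {ψ} (h : ψ.complexity < φ.complexity) : HasReduct ψ := ih _ h ψ rfl
    cases φ with
    | eq t t' => exact .atomic trivial
    | pred p ts => exact .atomic trivial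
    | and φ ψ =>
      exact .and (ih (by simp only [complexity]; omega)) (ih (by simp only [complexity]; omega))
    | neg φ => exact .neg (ih (by simp only [complexity]; omega))
    | know i φ => exact .know i (ih (by simp only [complexity]; omega))
    | assign x t φ => exact .assign x t (ih (by simp only [complexity]; omega))
    | announce ψ φ =>
      have hψ : HasReduct ψ := ih (by
        have := φ.complexity_pos
        simp only [complexity]; nlinarith)
      cases φ with
      | eq t t' =>
        exact .of_equivalent (.of_reductionAxiom (.AATOM ψ _ trivial)
            (sat_announce_atomic (by trivial)))
          (hψ.imp (.atomic trivial))
      | pred p ts =>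
        exact .of_equivalent (.of_reductionAxiom (.AATOM ψ _ trivial)
            (sat_announce_atomic (by trivial)))
          (hψ.imp (.atomic trivial))
      | and φ χ =>
        refine .of_equivalent (.of_reductionAxiom (.ACON ψ φ χ) sat_announce_and) (.and ?_ ?_) <;>
          exact ih (by simp only [complexity]; nlinarith)
      | neg φ =>
        refine .of_equivalent (.of_reductionAxiom (.ANEG ψ φ) sat_announce_neg) (hψ.imp (.neg ?_))
        exact ih (by simp only [complexity]; nlinarith)
      | know i φ =>
        refine .of_equivalent (.of_reductionAxiom (.AK ψ i φ) sat_announce_know)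
          (hψ.imp (.know i ?_))
        exact ih (by simp only [complexity]; nlinarith)
      | assign x t φ =>
        obtain ⟨z, hz⟩ := (finite_vars (announce ψ (assign x t φ))).exists_notMem
        refine .of_equivalent (.of_reductionAxiom (.AASSI ψ x t φ z hz) (sat_announce_assign hz))
          (.assign _ _ (.assign _ _ ?_))
        exact ih (by simp only [complexity, complexity_subst]; nlinarith)
      | announce χ φ =>
        refine .of_equivalent (.of_reductionAxiom (.ACOM ψ χ φ) sat_announce_announce) ?_
        refine ih ?_
        have := φ.complexity_pos
        simp only [complexity]
        rw [← mul_assoc]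
        gcongr
        nlinarith

/-! ### Sequences of assignments -/

/-- `[x₁ := y₁] … [xₖ := yₖ] φ`, for a list of pairs `(xⱼ, yⱼ)`. It serves as an explicit
substitution, which needs no renaming of bound variables. -/
def assigns (s : List (V × V)) (φ : Formula V N I P ar) : Formula V N I P ar :=
  s.foldr (fun p φ => assign p.1 (.var p.2) φ) φ

/-- The effect of a sequence of assignments on a valuation of the variables. -/
def updates {D : Type u} (s : List (V × V)) (σ : V → D) : V → D :=
  s.foldl (fun σ p => Function.update σ p.1 (σ p.2)) σ

omit [Infinite V] in
theorem sat_assigns {s : List (V × V)} {φ : Formula V N I P ar} {M : Model N I P ar} {w : M.W}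
    {σ : V → M.D} : Sat (assigns s φ) M w σ ↔ Sat φ M w (updates s σ) := by
  induction s generalizing σ with
  | nil => exact Iff.rfl
  | cons p s ih => exact ih

omit [Infinite V] in
theorem updates_of_notMem {D : Type u} {s : List (V × V)} {z : V} (hz : ∀ p ∈ s, z ≠ p.1)
    (σ : V → D) : updates s σ z = σ z := by
  induction s generalizing σ with
  | nil => rfl
  | cons p s ih =>
    rw [List.forall_mem_cons] at hz
    exact (ih hz.2 _).trans (Function.update_of_ne hz.1 _ _)

omit [DecidableEq V] [Infinite V] in
theorem assigns_append (s s' : List (V × V)) (φ : Formula V N I P ar) :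
    assigns (s ++ s') φ = assigns s (assigns s' φ) := List.foldr_append

omit [DecidableEq V] [Infinite V] in
theorem Basic.assigns {A : Set N} {φ : Formula V N I P ar} {n : ℕ} (h : Basic A φ n)
    (s : List (V × V)) : Basic A (PALAS.assigns s φ) n := by
  induction s with
  | nil => exact h
  | cons p s ih => exact ⟨fun _ h => Term.noConfusion rfl rfl (heq_of_eq h), ih⟩

omit [DecidableEq V] [Infinite V] in
theorem freeVars_assigns_subset {φ ψ : Formula V N I P ar} {T : Set V}
    (h : φ.freeVars ⊆ ψ.freeVars ∪ T) (s : List (V × V)) :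
    (assigns s φ).freeVars ⊆ (assigns s ψ).freeVars ∪ T := by
  induction s with
  | nil => exact h
  | cons p s ih =>
    rintro y (⟨hy, hyp⟩ | hy)
    · exact (ih hy).imp_left fun hy => Or.inl ⟨hy, hyp⟩
    · exact Or.inl (Or.inr hy)

namespace IsMCS

variable {Γ : Set (Formula V N I P ar)} (hΓ : IsMCS Γ)
include hΓ

theorem assigns_isMCS (s : List (V × V)) : IsMCS {φ | assigns s φ ∈ Γ} := by
  induction s generalizing Γ with
  | nil => exact hΓ
  | cons p s ih => exact ih (hΓ.after_isMCS p.1 (.var p.2))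

theorem assigns_know_mem {s : List (V × V)} {i : I} {φ : Formula V N I P ar} :
    assigns s (know i φ) ∈ Γ ↔ know i (assigns s φ) ∈ Γ := by
  induction s generalizing Γ with
  | nil => exact Iff.rfl
  | cons p s ih => exact (ih (hΓ.after_isMCS p.1 (.var p.2))).trans hΓ.know_mem_after

theorem assigns_mem_of_notMem {s : List (V × V)} {φ : Formula V N I P ar}
    (h : ∀ p ∈ s, p.1 ∉ φ.freeVars) : assigns s φ ∈ Γ ↔ φ ∈ Γ := by
  induction s generalizing Γ with
  | nil => exact Iff.rfl
  | cons p s ih =>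
    rw [List.forall_mem_cons] at h
    exact (ih (hΓ.after_isMCS p.1 (.var p.2)) h.2).trans (hΓ.mem_after_of_notMem_freeVars h.1)

end IsMCS

/-- A sequence of assignments in front of an atomic formula can be carried out as a
substitution. -/
theorem exists_atomic_of_assigns {p : Formula V N I P ar} (hp : p.IsAtomic) (s : List (V × V)) :
    ∃ q : Formula V N I P ar, q.IsAtomic ∧ Equivalent (assigns s p) q := by
  induction s with
  | nil => exact ⟨p, hp, .refl p⟩
  | cons r s ih =>
    obtain ⟨q, hq, he⟩ := ih
    refine ⟨subst r.2 r.1 q, ?_, (he.assign r.1 (.var r.2)).trans ⟨fun hΓ => ?_, ?_⟩⟩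
    · cases q <;> trivial
    · refine hΓ.mem_after_iff_subst_mem ?_
      cases q <;> trivial
    · intro M w σ
      cases q <;> first | exact hq.elim | (simp only [subst, Sat, Term.val_subst]; rfl)

/-! ### Gluing models below a root -/

/-- A family of pointed models, indexed by `K`, in which the variables from `X` satisfy the same
identities as in `Γ`. They are to become the successors of a world that realizes `Γ`. -/
structure Successors (Γ : Set (Formula V N I P ar)) (X : Set V) where
  /-- the index set -/
  K : Type u
  /-- the agent for which the model is a successor -/
  agent : K → I
  /-- the models -/
  model : K → Model N I P ar
  /-- their points -/
  world (k : K) : (model k).W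
  /-- their valuations of the variables -/
  val (k : K) : V → (model k).D
  val_eq_iff : ∀ k, ∀ x ∈ X, ∀ y ∈ X, val k x = val k y ↔ eq (.var x) (.var y) ∈ Γ

namespace Successors

variable {Γ : Set (Formula V N I P ar)} {X : Set V} (S : Successors Γ X) (hΓ : IsMCS Γ)

/-- Identity of terms according to `Γ`. -/
def _root_.PALAS.IsMCS.termSetoid : Setoid (Term V N) where
  r t t' := eq t t' ∈ Γ
  iseqv := ⟨hΓ.eq_refl, hΓ.eq_symm, hΓ.eq_trans⟩

/-- The domain of the glued model: the terms up to identity according to `Γ`, and the objects of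
the given models. -/
abbrev Dom : Type u := Quotient hΓ.termSetoid ⊕ Σ k, (S.model k).D

open Classical in
/-- The objects of the given models in the glued domain. Those that are the value of a variable
from `X` are identified with the class of that variable. -/
noncomputable def obj (k : S.K) (d : (S.model k).D) : S.Dom hΓ :=
  if h : ∃ x ∈ X, S.val k x = d then .inl (Quotient.mk _ (.var h.choose)) else .inr ⟨k, d⟩

theorem obj_val (k : S.K) {x : V} (hx : x ∈ X) :
    S.obj hΓ k (S.val k x) = .inl (Quotient.mk hΓ.termSetoid (.var x)) := by
  have h : ∃ y ∈ X, S.val k y = S.val k x := ⟨x, hx, rfl⟩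
  rw [obj, dif_pos h]
  congr 1
  exact Quotient.sound ((S.val_eq_iff k _ h.choose_spec.1 _ hx).1 h.choose_spec.2)

theorem obj_injective (k : S.K) : Function.Injective (S.obj hΓ k) := by
  intro d e hde
  unfold obj at hde
  split_ifs at hde with hd he he
  · rw [← hd.choose_spec.2, ← he.choose_spec.2]
    exact (S.val_eq_iff k _ hd.choose_spec.1 _ he.choose_spec.1).2
      (Quotient.exact (Sum.inl.inj hde))
  · simpa using hde

/-- The disjoint union of the given models over a common domain, with a new root `none` that sees
the points of the given models and realizes the atomic formulas of `Γ`. -/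
noncomputable def glue : Model N I P ar where
  W := Option (Σ k, (S.model k).W)
  D := S.Dom hΓ
  nonempty_W := ⟨none⟩
  nonempty_D := ⟨.inl (Quotient.mk _ (.var (Classical.arbitrary V)))⟩
  R i
    | none, v => ∃ k, S.agent k = i ∧ v = some ⟨k, S.world k⟩
    | some u, v => ∃ u', (S.model u.1).R i u.2 u' ∧ some ⟨u.1, u'⟩ = v
  ρ p
    | none, d => ∃ ts, (∀ j, d j = .inl (Quotient.mk _ (ts j))) ∧ pred p ts ∈ Γ
    | some u, d => ∃ e, (∀ j, d j = S.obj hΓ u.1 (e j)) ∧ (S.model u.1).ρ p u.2 e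
  η a
    | none => .inl (Quotient.mk _ (.name a))
    | some u => S.obj hΓ u.1 ((S.model u.1).η a u.2)

/-- The root of the glued model. -/
def root : (S.glue hΓ).W := none

/-- The valuation at the root, where each variable denotes its class. -/
def rootVal (x : V) : (S.glue hΓ).D := .inl (Quotient.mk _ (.var x))

/-- The inclusion of a given model into the glued model. -/
noncomputable def inclusion (k : S.K) : BoundedMorphism (S.model k) (S.glue hΓ) where
  world v := some ⟨k, v⟩
  obj := S.obj hΓ k
  obj_injective := S.obj_injective hΓ k
  rel_iff _ _ _ := Iff.rfl
  pred_iff p w d := by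
    constructor
    · rintro ⟨e, he, hρ⟩
      obtain rfl : d = e := funext fun j => S.obj_injective hΓ k (he j)
      exact hρ
    · exact fun h => ⟨d, fun _ => rfl, h⟩
  name_eq _ _ := rfl

theorem sat_world_iff (k : S.K) {φ : Formula V N I P ar} (hφ : φ.freeVars ⊆ X) :
    Sat φ (S.glue hΓ) ((S.inclusion hΓ k).world (S.world k)) (S.rootVal hΓ) ↔
      Sat φ (S.model k) (S.world k) (S.val k) :=
  sat_boundedMorphism φ (S.inclusion hΓ k) (S.world k)
    fun _ hx => (S.obj_val hΓ k (hφ hx)).symm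

theorem val_root (t : Term V N) :
    t.val (S.glue hΓ) (S.root hΓ) (S.rootVal hΓ) = .inl (Quotient.mk _ t) := by
  cases t <;> rfl

theorem sat_root_atomic {p : Formula V N I P ar} (hp : p.IsAtomic) :
    p ∈ Γ ↔ Sat p (S.glue hΓ) (S.root hΓ) (S.rootVal hΓ) := by
  cases p with
  | eq t t' =>
    simp only [Sat, val_root]
    exact ⟨fun h => congrArg Sum.inl (Quotient.sound h), fun h => Quotient.exact (Sum.inl.inj h)⟩
  | pred p ts =>
    simp only [Sat, val_root]
    constructor
    · exact fun h => ⟨ts, fun _ => rfl, h⟩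
    · rintro ⟨ts', he, h⟩
      exact hΓ.pred_mem_of_eq (fun k => hΓ.eq_symm (Quotient.exact (Sum.inl.inj (he k)))) h
  | _ => exact hp.elim

include hΓ in
/-- The truth lemma at the root. An assignment of a name is reduced to one of a variable with the
same value: a new variable `z` first receives the value of a witness `y` for the name. -/
theorem truth_root {A : Set N} {n : ℕ} (hX : Xᶜ.Infinite)
    (hwit : ∀ a ∈ A, ∃ y ∈ X, eq (.var y) (.name a) ∈ Γ)
    (hK : ∀ m, n = m + 1 → ∀ (i : I) (φ : Formula V N I P ar), Basic A φ m → φ.freeVars ⊆ X →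
      (know i φ ∈ Γ ↔ ∀ k, S.agent k = i → Sat φ (S.model k) (S.world k) (S.val k)))
    (φ : Formula V N I P ar) (hφ : Basic A φ n) (s : List (V × V))
    (hs : (assigns s φ).freeVars ⊆ X) :
    assigns s φ ∈ Γ ↔ Sat (assigns s φ) (S.glue hΓ) (S.root hΓ) (S.rootVal hΓ) := by
  have atomic {p : Formula V N I P ar} (hp : p.IsAtomic) (s : List (V × V)) :
      assigns s p ∈ Γ ↔ Sat (assigns s p) (S.glue hΓ) (S.root hΓ) (S.rootVal hΓ) := by
    obtain ⟨q, hq, he⟩ := exists_atomic_of_assigns hp s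
    rw [he.mem_iff hΓ, he.sat_iff, S.sat_root_atomic hΓ hq]
  have sub {φ ψ : Formula V N I P ar} (h : φ.freeVars ⊆ ψ.freeVars) (s : List (V × V))
      (hs : (assigns s ψ).freeVars ⊆ X) : (assigns s φ).freeVars ⊆ X := by
    have := freeVars_assigns_subset (T := ∅) (by simpa using h) s
    exact (this.trans_eq (Set.union_empty _)).trans hs
  induction φ generalizing s with
  | eq t t' => exact atomic (by trivial) s
  | pred p ts => exact atomic (by trivial) s
  | and φ ψ ihφ ihψ =>
    have h₁ := ihφ hφ.1 s (sub Set.subset_union_left s hs)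
    have h₂ := ihψ hφ.2 s (sub Set.subset_union_right s hs)
    rw [sat_assigns] at h₁ h₂ ⊢
    exact ((hΓ.assigns_isMCS s).and_mem).trans (and_congr h₁ h₂)
  | neg φ ih =>
    have h := ih hφ s (sub (φ := φ) (ψ := neg φ) subset_rfl s hs)
    rw [sat_assigns] at h ⊢
    exact ((hΓ.assigns_isMCS s).neg_mem).trans (not_congr h)
  | know i φ _ =>
    obtain _ | m := n
    · exact hφ.elim
    have hs' := sub (ψ := know i φ) (φ := φ) subset_rfl s hs
    rw [hΓ.assigns_know_mem, hK m rfl i _ (Basic.assigns (n := m) hφ s) hs', sat_assigns]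
    constructor
    · rintro h v ⟨k, hk, rfl⟩
      exact sat_assigns.1 ((S.sat_world_iff hΓ k hs').2 (h k hk))
    · intro h k hk
      exact (S.sat_world_iff hΓ k hs').1 (sat_assigns.2 (h _ ⟨k, hk, rfl⟩))
  | assign x t φ ih =>
    cases t with
    | var u =>
      have h : assigns s (assign x (.var u) φ) = assigns (s ++ [(x, u)]) φ :=
        (assigns_append s [(x, u)] φ).symm
      rw [h] at hs ⊢
      exact ih hφ.2 _ hs
    | name a =>
      obtain ⟨y, hy, hya⟩ := hwit a (hφ.1 a rfl)
      obtain ⟨z, hzX, hzs⟩ := hX.exists_notMem_finset (s.map Prod.fst).toFinset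
      have hzs : ∀ p ∈ s, z ≠ p.1 := by
        rintro p hp rfl
        exact hzs (List.mem_toFinset.2 (List.mem_map_of_mem hp))
      have hzy : y ≠ z := fun h => hzX (h ▸ hy)
      have hz : z ∉ (assigns s (assign x (.name a) φ)).freeVars := fun h => hzX (hs h)
      have hcons : assigns ((z, y) :: (s ++ [(x, z)])) φ =
          assign z (.var y) (assigns s (assign x (.var z) φ)) := by
        rw [← List.cons_append, assigns_append]
        rfl
      have hs' : (assigns ((z, y) :: (s ++ [(x, z)])) φ).freeVars ⊆ X := by
        rw [hcons]
        have := freeVars_assigns_subset (φ := assign x (.var z) φ) (ψ := assign x (.name a) φ)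
          (T := {z}) (by simp [freeVars, Term.vars]) s
        rintro v (⟨hv, hvz⟩ | rfl)
        · exact hs ((this hv).resolve_right hvz)
        · exact hy
      have hmem : assigns s (assign x (.name a) φ) ∈ Γ ↔
          assigns ((z, y) :: (s ++ [(x, z)])) φ ∈ Γ := by
        have hΔ := hΓ.after_isMCS z (.var y)
        have hza : eq (.var z) (.name a) ∈ after Γ z (.var y) :=
          hΔ.eq_trans (hΓ.eq_mem_after z _)
            ((hΓ.mem_after_of_notMem_freeVars (by simp [freeVars, Term.vars, hzy.symm])).2 hya)
        have hzas := (hΔ.assigns_mem_of_notMem (s := s) (φ := eq (.var z) (.name a)) (by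
          rintro p hp
          simpa [freeVars, Term.vars] using (hzs p hp).symm)).2 hza
        rw [hcons, ← hΓ.mem_after_of_notMem_freeVars (t := .var y) hz]
        exact (Set.ext_iff.1 ((hΔ.assigns_isMCS s).after_congr (x := x) hzas) φ).symm
      refine hmem.trans ((ih hφ.2 _ hs').trans ?_)
      rw [hcons]
      -- `z` is not free in the formula, so it may take the value of the witness
      have hsat : Sat (assigns s (assign x (.name a) φ)) (S.glue hΓ) (S.root hΓ)
            (Function.update (S.rootVal hΓ) z (S.rootVal hΓ y)) ↔
          Sat (assigns s (assign x (.name a) φ)) (S.glue hΓ) (S.root hΓ) (S.rootVal hΓ) :=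
        sat_congr _ fun v hv => Function.update_of_ne (fun h => hz (by rwa [h] at hv)) _ _
      rw [← hsat]
      have hval : updates s (Function.update (S.rootVal hΓ) z (S.rootVal hΓ y)) z =
          (S.glue hΓ).η a (S.root hΓ) := by
        rw [updates_of_notMem hzs, Function.update_self]
        exact congrArg Sum.inl (Quotient.sound hya)
      change Sat (assigns s _) _ _ (Function.update (S.rootVal hΓ) z (S.rootVal hΓ y)) ↔ _
      rw [sat_assigns, sat_assigns]
      simp only [Sat, Term.val, hval]
  | announce ψ φ => exact hφ.elim

end Successors

/-! ### Completeness -/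

/-- Assigning the names from `A` to new variables, one after the other, provides witnesses for
these names without affecting formulas over `X`. -/
theorem IsMCS.exists_witnesses {A : Set N} (hA : A.Finite) {Γ : Set (Formula V N I P ar)}
    (hΓ : IsMCS Γ) {X : Set V} (hX : Xᶜ.Infinite) :
    ∃ (Γ' : Set (Formula V N I P ar)) (X' : Set V), IsMCS Γ' ∧ X'ᶜ.Infinite ∧ X ⊆ X' ∧
      (∀ φ : Formula V N I P ar, φ.freeVars ⊆ X → (φ ∈ Γ' ↔ φ ∈ Γ)) ∧
      ∀ a ∈ A, ∃ y ∈ X', eq (.var y) (.name a) ∈ Γ' := by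
  induction A, hA using Set.Finite.induction_on with
  | empty => exact ⟨Γ, X, hΓ, hX, subset_rfl, fun _ _ => Iff.rfl, by simp⟩
  | @insert a A _ _ ih =>
    obtain ⟨Γ', X', hΓ', hX', hXX', hiff, hwit⟩ := ih
    obtain ⟨y, hy⟩ := hX'.nonempty
    have key {φ : Formula V N I P ar} (hφ : φ.freeVars ⊆ X') :
        φ ∈ after Γ' y (.name a) ↔ φ ∈ Γ' :=
      hΓ'.mem_after_of_notMem_freeVars fun h => hy (hφ h)
    refine ⟨after Γ' y (.name a), insert y X', hΓ'.after_isMCS y _, ?_,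
      hXX'.trans (Set.subset_insert _ _), fun φ hφ => ?_, ?_⟩
    · have := hX'.sdiff (Set.finite_singleton y)
      refine this.mono fun v hv => ?_
      rintro (h | h)
      · exact hv.2 h
      · exact hv.1 h
    · rw [key (hφ.trans hXX'), hiff φ hφ]
    · rintro b (rfl | hb)
      · exact ⟨y, Set.mem_insert _ _, hΓ'.eq_mem_after y _⟩
      · obtain ⟨v, hv, h⟩ := hwit b hb
        refine ⟨v, Set.mem_insert_of_mem _ hv, (key ?_).2 h⟩
        simpa [freeVars, Term.vars] using hv

/-- Every maximal consistent set has a model, as far as formulas of bounded modal depth over a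
co-infinite set of variables are concerned, by induction on the depth. -/
theorem IsMCS.exists_model {A : Set N} (hA : A.Finite) (n : ℕ) {Γ : Set (Formula V N I P ar)}
    (hΓ : IsMCS Γ) {X : Set V} (hX : Xᶜ.Infinite) :
    ∃ (M : Model N I P ar) (w : M.W) (σ : V → M.D), ∀ φ : Formula V N I P ar,
      Basic A φ n → φ.freeVars ⊆ X → (φ ∈ Γ ↔ Sat φ M w σ) := by
  induction n generalizing Γ X with
  | zero =>
    obtain ⟨Γ', X', hΓ', hX', hXX', hiff, hwit⟩ := hΓ.exists_witnesses hA hX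
    let S : Successors Γ' X' := ⟨PEmpty, nofun, nofun, nofun, nofun, fun k => k.elim⟩
    refine ⟨S.glue hΓ', S.root hΓ', S.rootVal hΓ', fun φ hb hφ => ?_⟩
    rw [← hiff φ hφ]
    exact S.truth_root hΓ' hX' hwit (fun m hm => by omega) φ hb [] (hφ.trans hXX')
  | succ n ih =>
    obtain ⟨Γ', X', hΓ', hX', hXX', hiff, hwit⟩ := hΓ.exists_witnesses hA hX
    choose Δ hΔ hsub hnot using fun k : {p : I × Formula V N I P ar // know p.1 p.2 ∉ Γ'} =>
      hΓ'.exists_successor k.2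
    choose M w σ hM using fun k => ih (hΔ k) hX'
    let S : Successors Γ' X' :=
      { K := {p : I × Formula V N I P ar // know p.1 p.2 ∉ Γ'}
        agent := fun k => k.1.1
        model := M
        world := w
        val := σ
        val_eq_iff := by
          intro k x hx y hy
          rw [← hΓ'.var_eq_mem_successor (hΔ k) (hsub k)]
          refine (hM k (eq (.var x) (.var y)) ?_ ?_).symm
          · trivial
          · simp [freeVars, Term.vars, Set.insert_subset_iff, hx, hy] }
    refine ⟨S.glue hΓ', S.root hΓ', S.rootVal hΓ', fun φ hb hφ => ?_⟩
    rw [← hiff φ hφ]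
    refine S.truth_root hΓ' hX' hwit ?_ φ hb [] (hφ.trans hXX')
    intro m hm i ψ hψ hψX
    obtain rfl : n = m := by omega
    constructor
    · rintro h k rfl
      exact (hM k ψ hψ hψX).1 (hsub k ψ h)
    · intro h
      by_contra hn
      exact hnot ⟨(i, ψ), hn⟩ ((hM ⟨(i, ψ), hn⟩ ψ hψ hψX).2 (h ⟨(i, ψ), hn⟩ rfl))

end PALAS

/-- Completeness of `SPALAS` over arbitrary models: every valid formula is derivable. -/
theorem mainTheorem2 {V N I P : Type u} {ar : P → ℕ} [DecidableEq V] [Infinite V]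
    (φ : PALAS.Formula V N I P ar) (hφ : PALAS.Valid φ) : PALAS.SPALAS φ := by
  refine PALAS.spalas_of_forall_isMCS fun Γ hΓ => ?_
  obtain ⟨φ', A, n, hA, hb, he⟩ := PALAS.hasReduct φ
  have hX : (φ'.freeVarsᶜ).Infinite :=
    (φ'.finite_vars.subset φ'.freeVars_subset_vars).infinite_compl
  obtain ⟨M, w, σ, h⟩ := hΓ.exists_model hA n hX
  rw [he.mem_iff hΓ, h φ' hb subset_rfl, ← he.sat_iff]
  exact hφ M w σ
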